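/- Let $(X,m)$ and $(Y,\nu)$ each be the unit interval with Lebesgue measure, and let $(Z,\mu)=(X\times Y,\,m\times\nu)$. For a measure space $W$ let $\mathcal G(W)$ be the set of invertible measure-preserving transformations of $W$ (identified when equal almost everywhere), with the weak topology, for which the sets $\{S : \lambda(TE\,\triangle\,SE)<\varepsilon\}$ ($T\in\mathcal G(W)$, $E$ measurable, $\varepsilon>0$, $\lambda$ the measure of $W$) form a subbase. For $T_0\in\mathcal G(X)$ let $\mathcal G_{T_0}\subset\mathcal G(Z)$, with the subspace topology, be the set of extensions of $T_0$, i.e. of those $T$ with $\pi\circ T=T_0\circ\pi$ almost everywhere, where $\pi:Z\to X$ is the projection. Let $L^2(Z|X)$ be the set of complex-valued $f\in L^2(Z)$ with $\mathbb E(|f|^2\mid X)^{1/2}\in L^\infty(X)$. Call $T\in\mathcal G_{T_0}$ a strongly mixing extension of $T_0$ if for all $f,g\in L^2(Z|X)$ $$\lim_{n\to\infty}\bigl\|\mathbb E(T^nf\cdot\overline g\mid X)-T_0^n\mathbb E(f\mid X)\,\mathbb E(\overline g\mid X)\bigr\|_{L^2(X)}=0,$$ where $T^nf=f\circ T^n$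 and $T_0^nh=h\circ T_0^n$, and let $\mathcal S_{T_0}\subset\mathcal G_{T_0}$ be the set of strongly mixing extensions of $T_0$. **Theorem.** If $T_0\in\mathcal G(X)$ is periodic, i.e. $T_0^p=\mathrm{id}_X$ almost everywhere for some integer $p\ge1$, then $\mathcal S_{T_0}$ is a first-category (meagre) subset of $\mathcal G_{T_0}$. -/

import Mathlib

open MeasureTheory Filter Topology
open scoped unitInterval ENNReal symmDiff

namespace MixExt

section Transformations

variable {X : Type*} [MeasurableSpace X]

/-- Everywhere defined invertible bimeasurable maps of `X` that preserve `μ`. (A transformation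
that is only invertible between invariant sets of full measure agrees almost everywhere with one
of these: replace it by the identity off such a set.) -/
def MPEquiv (μ : Measure X) : Type _ :=
  {e : X ≃ᵐ X // MeasurePreserving e μ μ}

/-- Equality almost everywhere. -/
instance MPEquiv.aeSetoid (μ : Measure X) : Setoid (MPEquiv μ) where
  r e f := ∀ᵐ x ∂μ, e.1 x = f.1 x
  iseqv :=
    { refl := fun _ => Eventually.of_forall fun _ => rfl
      symm := fun h => h.mono fun _ hx => hx.symm
      trans := fun h k => by
        filter_upwards [h, k] with x hx kx using hx.trans kx }

/-- `𝒢(X)`: the invertible measure-preserving transformations of `(X, μ)`, two of them being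
identified when they agree almost everywhere. -/
def Transf (μ : Measure X) : Type _ := Quotient (MPEquiv.aeSetoid μ)

namespace Transf

variable {μ : Measure X}

/-- The class of an invertible measure-preserving map. -/
def mk (e : X ≃ᵐ X) (he : MeasurePreserving e μ μ) : Transf μ :=
  Quotient.mk (MPEquiv.aeSetoid μ) ⟨e, he⟩

/-- A representative of the class; everything below depends on it only up to null sets. -/
noncomputable def rep (T : Transf μ) : X ≃ᵐ X := (Quotient.out T).1

theorem measurePreserving_rep (T : Transf μ) : MeasurePreserving T.rep μ μ :=
  (Quotient.out T).2

theorem rep_mk (e : X ≃ᵐ X) (he : MeasurePreserving e μ μ) :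
    ∀ᵐ x ∂μ, (mk e he).rep x = e x :=
  Quotient.mk_out (s := MPEquiv.aeSetoid μ) ⟨e, he⟩

theorem ext_rep {S T : Transf μ} (h : ∀ᵐ x ∂μ, S.rep x = T.rep x) : S = T :=
  Quotient.out_equiv_out.mp h

/-- The weak topology: the sets `{S | μ (T E ∆ S E) < ε}`, for `T` in `𝒢(X)`, `E` measurable
and `ε > 0`, form a subbase. -/
instance weakTopology (μ : Measure X) : TopologicalSpace (Transf μ) :=
  TopologicalSpace.generateFrom
    {U | ∃ (T : Transf μ) (E : Set X) (ε : ℝ≥0∞), MeasurableSet E ∧ 0 < ε ∧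
      U = {S : Transf μ | μ ((T.rep '' E) ∆ (S.rep '' E)) < ε}}

/-- `T` is periodic: `T ^ p` is the identity of `𝒢(X)` for some `p ≥ 1`. -/
def IsPeriodic (T : Transf μ) : Prop :=
  ∃ p : ℕ, 1 ≤ p ∧ ∀ᵐ x ∂μ, T.rep^[p] x = x

end Transf

end Transformations

section Extensions

variable {X Y : Type*} [MeasurableSpace X] [MeasurableSpace Y]

/-- `T` in `𝒢(X × Y)` is an extension of `T₀` in `𝒢(X)` through the projection to `X`. -/
def IsExtension {m : Measure X} {ν : Measure Y} (T₀ : Transf m) (T : Transf (m.prod ν)) : Prop :=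
  ∀ᵐ z ∂(m.prod ν), (T.rep z).1 = T₀.rep z.1

/-- `𝒢_{T₀}`, with the topology induced by the weak topology of `𝒢(X × Y)`. -/
abbrev Extension {m : Measure X} (ν : Measure Y) (T₀ : Transf m) : Type _ :=
  {T : Transf (m.prod ν) // IsExtension T₀ T}

/-- The σ-algebra on `X × Y` pulled back from `X` by the projection. -/
abbrev baseSigma (X Y : Type*) [MeasurableSpace X] : MeasurableSpace (X × Y) :=
  MeasurableSpace.comap Prod.fst inferInstance

/-- The conditional norm `‖f‖_{L²(Z|X)} = E(|f|² | X)^{1/2}`, `Z = X × Y`, viewed as a function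
on `Z` that is measurable with respect to `X`. -/
noncomputable def condNorm (m : Measure X) (ν : Measure Y) (f : X × Y → ℂ) : X × Y → ℝ :=
  fun z => √((m.prod ν)[fun w => ‖f w‖ ^ 2 | baseSigma X Y] z)

/-- Membership in `L²(Z|X)`: `f` is in `L²(Z)` and its conditional norm is in `L^∞`. -/
def MemCondL2 (m : Measure X) (ν : Measure Y) (f : X × Y → ℂ) : Prop :=
  MemLp f 2 (m.prod ν) ∧ MemLp (condNorm m ν f) ∞ (m.prod ν)

/-- `T` is a strongly mixing extension of `T₀`: for all `f, g ∈ L²(Z|X)`,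
`‖E(Tⁿ f · conj g | X) - T₀ⁿ E(f | X) · E(conj g | X)‖ → 0` in `L²`. Here `Tⁿ f = f ∘ Tⁿ`, and
functions on `X` are viewed as functions on `Z`, on which `T₀` acts as `T₀ × 1`. -/
def IsStronglyMixingExtension {m : Measure X} {ν : Measure Y} (T₀ : Transf m)
    (T : Transf (m.prod ν)) : Prop :=
  ∀ f g : X × Y → ℂ, MemCondL2 m ν f → MemCondL2 m ν g →
    Tendsto
      (fun n : ℕ => eLpNorm
        (fun z : X × Y =>
          ((m.prod ν)[fun w => f (T.rep^[n] w) * starRingEnd ℂ (g w) | baseSigma X Y]) z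
            - ((m.prod ν)[f | baseSigma X Y]) (T₀.rep^[n] z.1, z.2)
              * ((m.prod ν)[fun w => starRingEnd ℂ (g w) | baseSigma X Y]) z)
        2 (m.prod ν))
      atTop (𝓝 0)

/-- `𝒮_{T₀}`: the set of strongly mixing extensions of `T₀`, as a subset of `𝒢_{T₀}`. -/
def stronglyMixingExtensions {m : Measure X} (ν : Measure Y) (T₀ : Transf m) :
    Set (Extension ν T₀) :=
  {T | IsStronglyMixingExtension T₀ T.1}

end Extensions

end MixExt

/-!
The argument is Rokhlin's: strong mixing forces a set to become independent of its iterates, whereas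
the periodic extensions, some iterates of which are the identity, are dense.

Let `A = X × J` with `J` of measure `1/2`. If `T` is a strongly mixing extension of `T₀`, then
`μ (A ∩ Tⁿ A) → 1/4` (`IsStronglyMixingExtension.tendsto_measure`), so `T` lies outside one of the
sets `G N = {T | ∃ n ≥ N, μ (A ∩ Tⁿ A) > 1/3}`. These sets are open in the weak topology, because
`S ↦ Sⁿ A` is continuous (`Transf.tendsto_iterate_image`). They contain every periodic extension,
since a power of it with large exponent is the identity and `μ A = 1/2`. It remains to see that the
periodic extensions are dense (`exists_tendsto_periodic`).

For this, cut the fiber `[0, 1]` into `N` cells of length `1/N` and approximate `T` by a map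
`(x, y) ↦ (T₀ x, ρ y)`, where the permutation `ρ` of the cells depends measurably on `T₀ x`
(`skewEquiv`). As `T₀` is periodic and the permutations form a finite group, this map is periodic
(`skewEquiv_periodic`). That it can be taken close to `T` is shown fiber by fiber. Write `Tₓ⁻¹ y`
for the second coordinate of `T⁻¹ (x, y)`. The matrix
`N · ν {y | Tₓ⁻¹ y in the l-th cell, y in the j-th cell}` is doubly stochastic because almost every
fiber map `Tₓ⁻¹` preserves `ν` (`ae_measure_fiber_symm_eq`), so by Birkhoff's theorem it is an
average of permutation matrices. Fix a coarser partition into `k` cells, with `k ∣ N`. For some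
permutation in this average, the coarse cells of `Tₓ⁻¹ y` and `ρ⁻¹ y` differ only on a set
of measure at most the sum, over the `k` coarse cells `C`, of the error made in approximating `Tₓ C` by unions of
cells of length `1/N` (`exists_perm_measure_le`). This error (`osc`) tends to `0` as `N → ∞`. An
optimal `ρ` can be chosen measurably in `x` as there are finitely many of them, and dominated
convergence turns the fiberwise estimates into one on `X × [0, 1]` (`exists_skewEquiv_near`).
-/

namespace MixExt

/-! ### Permutations of the cells of the unit interval -/

section Cells

/-- The index of the cell `[l / N, (l + 1) / N)` of the unit interval that contains `y`. The
endpoint `1` is put into the last cell, so that the cells partition the unit interval. -/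
noncomputable def cell (N : ℕ) [NeZero N] (y : I) : Fin N :=
  ⟨min ⌊(N : ℝ) * y⌋₊ (N - 1), by have := NeZero.pos N; omega⟩

variable {N : ℕ} [NeZero N]

theorem cell_mono : Monotone (cell N) := by
  intro y z h
  rw [Fin.le_def]
  simp only [cell]
  have : (y : ℝ) ≤ z := h
  gcongr

theorem measurable_cell : Measurable (cell N) :=
  cell_mono.measurable

theorem measurableSet_cell (l : Fin N) : MeasurableSet (cell N ⁻¹' {l}) :=
  measurable_cell (measurableSet_singleton l)

theorem val_cell {y : I} (hy : y ≠ 1) : ((cell N y : Fin N) : ℕ) = ⌊(N : ℝ) * y⌋₊ := by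
  have h1 : (y : ℝ) < 1 := unitInterval.lt_one_iff_ne_one.mpr hy
  have hN : (0 : ℝ) < N := by exact_mod_cast NeZero.pos N
  have : ⌊(N : ℝ) * y⌋₊ < N := by
    rw [Nat.floor_lt (mul_nonneg hN.le y.2.1)]
    nlinarith
  simp only [cell]
  omega

theorem cell_eq_of_mem {y : I} {l : Fin N} (h₁ : (l : ℝ) ≤ N * y) (h₂ : (N : ℝ) * y < l + 1) :
    cell N y = l := by
  have : ⌊(N : ℝ) * y⌋₊ = l := (Nat.floor_eq_iff ((Nat.cast_nonneg _).trans h₁)).mpr ⟨h₁, h₂⟩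
  ext
  simp only [cell]
  omega

/-- Cells of length `1 / (k * M)` refine those of length `1 / k`. -/
theorem divNat_cell (k M : ℕ) [NeZero k] [NeZero M] (y : I) :
    (cell (k * M) y).divNat = cell k y := by
  have hM := NeZero.pos M
  have hk := NeZero.pos k
  ext
  simp only [cell, Fin.divNat]
  have h : ⌊(k : ℝ) * y⌋₊ = ⌊((k * M : ℕ) : ℝ) * y⌋₊ / M := by
    rw [← Nat.floor_div_natCast]
    congr 1
    push_cast
    field_simp
  rw [h]
  generalize ⌊((k * M : ℕ) : ℝ) * y⌋₊ = n
  obtain ⟨k, rfl⟩ : ∃ j, k = j + 1 := ⟨k - 1, by omega⟩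
  have h2 : (k + 1) * M - 1 = M * k + (M - 1) := by
    have : (k + 1) * M = M * k + M := by ring
    omega
  have h3 : (M * k + (M - 1)) / M = k := by
    rw [Nat.mul_add_div hM, Nat.div_eq_of_lt (by omega), add_zero]
  rcases le_total n ((k + 1) * M - 1) with hn | hn
  · rw [min_eq_left hn, min_eq_left]
    calc n / M ≤ ((k + 1) * M - 1) / M := Nat.div_le_div_right hn
      _ = k := by rw [h2, h3]
  · rw [min_eq_right hn, min_eq_right, h2, h3]
    · rfl
    · calc k = ((k + 1) * M - 1) / M := by rw [h2, h3]
        _ ≤ n / M := Nat.div_le_div_right hn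

/-- The map of the unit interval that translates the `l`-th cell to the `ρ l`-th one. The endpoint
`1` is kept fixed. -/
noncomputable def permMap (ρ : Equiv.Perm (Fin N)) (y : I) : I :=
  if y = 1 then 1 else
    Set.projIcc 0 1 zero_le_one ((y : ℝ) + ((ρ (cell N y) : ℕ) - (cell N y : ℕ) : ℝ) / N)

theorem permMap_one_right (ρ : Equiv.Perm (Fin N)) : permMap ρ 1 = 1 := if_pos rfl

theorem mul_permMap (ρ : Equiv.Perm (Fin N)) {y : I} (hy : y ≠ 1) :
    (N : ℝ) * permMap ρ y = (ρ (cell N y) : ℕ) + Int.fract ((N : ℝ) * y) := by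
  have hN : (0 : ℝ) < N := by exact_mod_cast NeZero.pos N
  have h0 : (0 : ℝ) ≤ N * y := mul_nonneg hN.le y.2.1
  have hf : (N : ℝ) * y = (cell N y : ℕ) + Int.fract ((N : ℝ) * y) := by
    rw [val_cell hy, natCast_floor_eq_intCast_floor h0, Int.floor_add_fract]
  have hlt : ((ρ (cell N y) : ℕ) : ℝ) + 1 ≤ N := by exact_mod_cast (ρ (cell N y)).2
  have h1 := Int.fract_lt_one ((N : ℝ) * y)
  have h2 := Int.fract_nonneg ((N : ℝ) * y)
  have key : (y : ℝ) + ((ρ (cell N y) : ℕ) - (cell N y : ℕ) : ℝ) / N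
      = ((ρ (cell N y) : ℕ) + Int.fract ((N : ℝ) * y)) / N := by
    rw [eq_div_iff hN.ne', add_mul, div_mul_cancel₀ _ hN.ne']
    linarith
  rw [permMap, if_neg hy, key, Set.projIcc_of_mem zero_le_one (x := _) ⟨by positivity, ?_⟩]
  · simp only
    field_simp
  · rw [div_le_one hN]
    linarith

theorem permMap_ne_one (ρ : Equiv.Perm (Fin N)) {y : I} (hy : y ≠ 1) : permMap ρ y ≠ 1 := by
  intro h
  have := mul_permMap ρ hy
  rw [h] at this
  have hlt : ((ρ (cell N y) : ℕ) : ℝ) + 1 ≤ N := by exact_mod_cast (ρ (cell N y)).2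
  have h1 := Int.fract_lt_one ((N : ℝ) * y)
  simp at this
  linarith

theorem cell_permMap (ρ : Equiv.Perm (Fin N)) {y : I} (hy : y ≠ 1) :
    cell N (permMap ρ y) = ρ (cell N y) := by
  have h1 := Int.fract_lt_one ((N : ℝ) * y)
  have h2 := Int.fract_nonneg ((N : ℝ) * y)
  apply cell_eq_of_mem <;> rw [mul_permMap ρ hy] <;> linarith

theorem permMap_permMap (ρ τ : Equiv.Perm (Fin N)) (y : I) :
    permMap ρ (permMap τ y) = permMap (ρ * τ) y := by
  by_cases hy : y = 1
  · simp [hy, permMap_one_right]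
  have hN : (N : ℝ) ≠ 0 := by exact_mod_cast NeZero.ne N
  apply Subtype.ext
  apply mul_left_cancel₀ hN
  rw [mul_permMap ρ (permMap_ne_one τ hy), cell_permMap τ hy, mul_permMap τ hy, mul_permMap _ hy,
    Int.fract_natCast_add, Int.fract_fract]
  rfl

theorem permMap_one (y : I) : permMap (1 : Equiv.Perm (Fin N)) y = y := by
  unfold permMap
  split_ifs with h
  · exact h.symm
  · simp

theorem measurable_permMap (ρ : Equiv.Perm (Fin N)) : Measurable (permMap ρ) := by
  refine Measurable.ite (measurableSet_singleton 1) measurable_const ?_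
  refine continuous_projIcc.measurable.comp (measurable_subtype_coe.add (Measurable.div_const ?_ _))
  exact (measurable_of_finite (fun l : Fin N => ((ρ l : ℕ) - (l : ℕ) : ℝ))).comp measurable_cell

theorem ae_ne_one : ∀ᵐ y : I, y ≠ 1 := by
  rw [ae_iff]
  simp

/-- A cell is translated onto its image, so `permMap` preserves Lebesgue measure on each cell. -/
theorem volume_preimage_permMap_inter_cell (ρ : Equiv.Perm (Fin N)) (B : Set I)
    (l : Fin N) :
    volume (permMap ρ ⁻¹' B ∩ cell N ⁻¹' {l}) = volume (B ∩ cell N ⁻¹' {ρ l}) := by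
  have hN : (0 : ℝ) < N := by exact_mod_cast NeZero.pos N
  have hd : ∀ s : Set I, volume s = volume (s \ {1}) := fun s =>
    (measure_sdiff_null (by simp)).symm
  rw [hd, hd (B ∩ _), unitInterval.volume_apply, unitInterval.volume_apply]
  set t : ℝ := ((ρ l : ℕ) - (l : ℕ) : ℝ) / N with ht
  rw [← measure_preimage_add_right volume t (Subtype.val '' ((B ∩ cell N ⁻¹' {ρ l}) \ {1}))]
  congr 1
  have hval : ∀ (y : I), y ≠ 1 → cell N y = l → (permMap ρ y : ℝ) = y + t := by
    intro y hy hl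
    have := mul_permMap ρ hy
    have hf : (N : ℝ) * y = (cell N y : ℕ) + Int.fract ((N : ℝ) * y) := by
      rw [val_cell hy, natCast_floor_eq_intCast_floor (mul_nonneg hN.le y.2.1),
        Int.floor_add_fract]
    rw [hl] at this hf
    rw [ht]
    field_simp
    linarith
  ext r
  simp only [Set.mem_image, Set.mem_sdiff, Set.mem_inter_iff, Set.mem_preimage,
    Set.mem_singleton_iff]
  constructor
  · rintro ⟨y, ⟨⟨hB, hl⟩, hy⟩, rfl⟩
    exact ⟨permMap ρ y, ⟨⟨hB, by rw [cell_permMap ρ hy, hl]⟩, permMap_ne_one ρ hy⟩, hval y hy hl⟩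
  · rintro ⟨z, ⟨⟨hB, hl⟩, hz⟩, hr⟩
    have hc : cell N (permMap ρ⁻¹ z) = l := by rw [cell_permMap _ hz, hl]; simp
    have hi : permMap ρ (permMap ρ⁻¹ z) = z := by rw [permMap_permMap]; simp [permMap_one]
    have hne := permMap_ne_one ρ⁻¹ hz
    refine ⟨permMap ρ⁻¹ z, ⟨⟨by rwa [hi], hc⟩, hne⟩, ?_⟩
    have := hval _ hne hc
    rw [hi] at this
    linarith

theorem measure_eq_sum_fiber {Ω ι : Type*} [MeasurableSpace Ω] [Fintype ι] [MeasurableSpace ι]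
    [MeasurableSingletonClass ι] (μ : Measure Ω) {c : Ω → ι} (hc : Measurable c) (s : Set Ω) :
    μ s = ∑ l, μ (s ∩ c ⁻¹' {l}) := by
  have h := sum_measure_preimage_singleton (μ := μ.restrict s) Finset.univ
    fun l _ => hc (measurableSet_singleton l)
  rw [Finset.coe_univ, Set.preimage_univ, Measure.restrict_apply_univ] at h
  rw [← h]
  refine Finset.sum_congr rfl fun l _ => ?_
  rw [Measure.restrict_apply (hc (measurableSet_singleton l)), Set.inter_comm]

theorem measurePreserving_permMap (ρ : Equiv.Perm (Fin N)) :
    MeasurePreserving (permMap ρ) volume volume := by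
  refine ⟨measurable_permMap ρ, Measure.ext fun B hB => ?_⟩
  rw [Measure.map_apply (measurable_permMap ρ) hB,
    measure_eq_sum_fiber volume (measurable_cell (N := N)) B,
    measure_eq_sum_fiber volume (measurable_cell (N := N)) (permMap ρ ⁻¹' B)]
  simp_rw [volume_preimage_permMap_inter_cell]
  exact Equiv.sum_comp ρ (fun l => volume (B ∩ cell N ⁻¹' {l}))

/-- All cells have the same measure, because `permMap` permutes them. -/
theorem volume_cell (l : Fin N) : volume (cell N ⁻¹' {l}) = (N : ℝ≥0∞)⁻¹ := by
  have h : ∀ l', volume (cell N ⁻¹' {l'}) = volume (cell N ⁻¹' {l}) := by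
    intro l'
    have := volume_preimage_permMap_inter_cell (Equiv.swap l' l) Set.univ l'
    simpa using this
  have hs := measure_eq_sum_fiber volume (measurable_cell (N := N)) Set.univ
  simp only [Set.univ_inter, h, Finset.sum_const, measure_univ, Finset.card_univ,
    Fintype.card_fin, nsmul_eq_mul] at hs
  exact ENNReal.eq_inv_of_mul_eq_one_left (by rw [mul_comm]; exact hs.symm)

end Cells

/-! ### Approximation of measurable sets by unions of cells -/

section Approximation

/-- Let the `Φ i` be subadditive set functions that are invariant under complements and uniformly
dominated by a finite measure. If they tend to zero on a π-system generating the σ-algebra, then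
they tend to zero on every measurable set. -/
theorem tendsto_zero_of_isPiSystem {Ω ι : Type*} [mΩ : MeasurableSpace Ω] {μ : Measure Ω}
    [IsFiniteMeasure μ] {l : Filter ι} {Φ : ι → Set Ω → ℝ≥0∞} {C : ℝ≥0∞} (hC : C ≠ ∞)
    (hunion : ∀ i E F, Φ i (E ∪ F) ≤ Φ i E + Φ i F) (hle : ∀ i E, MeasurableSet E → Φ i E ≤ C * μ E)
    (hcompl : ∀ i E, Φ i Eᶜ = Φ i E) {s : Set (Set Ω)}
    (hgen : mΩ = MeasurableSpace.generateFrom s) (hpi : IsPiSystem s)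
    (hs : ∀ t ∈ s, Tendsto (fun i => Φ i t) l (𝓝 0)) {E : Set Ω} (hE : MeasurableSet E) :
    Tendsto (fun i => Φ i E) l (𝓝 0) := by
  have hempty : ∀ i, Φ i ∅ = 0 := fun i => by simpa using hle i ∅ MeasurableSet.empty
  induction E, hE using MeasurableSpace.induction_on_inter hgen hpi with
  | empty => simpa [hempty] using tendsto_const_nhds
  | basic t ht => exact hs t ht
  | compl t _ ih => simpa [hcompl] using ih
  | iUnion f hd hm ih =>
    have hfin : ∀ n, Tendsto (fun i => Φ i (⋃ j < n, f j)) l (𝓝 0) := by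
      intro n
      induction n with
      | zero => simpa [hempty] using tendsto_const_nhds
      | succ n ihn =>
        have h0 := ihn.add (ih n)
        rw [add_zero] at h0
        refine tendsto_of_tendsto_of_tendsto_of_le_of_le tendsto_const_nhds h0
          (fun _ => zero_le) fun i => ?_
        simp only [Set.biUnion_lt_succ]
        exact hunion i _ _
    have htail := tendsto_measure_biUnion_Ici_zero_of_pairwise_disjoint (μ := μ)
      (fun i => (hm i).nullMeasurableSet) hd
    have htail' := ENNReal.Tendsto.const_mul (a := C) htail (Or.inr hC)
    rw [mul_zero] at htail'
    rw [ENNReal.tendsto_nhds_zero]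
    intro ε hε
    have hε2 : 0 < ε / 2 := ENNReal.half_pos hε.ne'
    obtain ⟨n, hn⟩ := ((ENNReal.tendsto_nhds_zero.mp htail') _ hε2).exists
    filter_upwards [(ENNReal.tendsto_nhds_zero.mp (hfin n)) _ hε2] with i hi
    have hsplit : (⋃ j, f j) = (⋃ j < n, f j) ∪ ⋃ j ≥ n, f j := by
      ext x
      simp only [Set.mem_iUnion, Set.mem_union, exists_prop]
      constructor
      · rintro ⟨j, hj⟩
        rcases lt_or_ge j n with h | h
        exacts [Or.inl ⟨j, h, hj⟩, Or.inr ⟨j, h, hj⟩]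
      · rintro (⟨j, -, hj⟩ | ⟨j, -, hj⟩) <;> exact ⟨j, hj⟩
    calc Φ i (⋃ j, f j) ≤ Φ i (⋃ j < n, f j) + Φ i (⋃ j ≥ n, f j) := by
          rw [hsplit]; exact hunion i _ _
      _ ≤ ε / 2 + ε / 2 := by
          gcongr
          exact (hle i _ (MeasurableSet.biUnion (Set.to_countable _) fun j _ => hm j)).trans hn
      _ = ε := ENNReal.add_halves ε

/-- How badly a set `E` is resolved by the partition into the fibers of `c`: the distance, with
respect to `μ`, from `E` to the closest union of fibers. -/
noncomputable def osc {Ω ι : Type*} [MeasurableSpace Ω] [Fintype ι] (μ : Measure Ω) (c : Ω → ι)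
    (E : Set Ω) : ℝ≥0∞ :=
  ∑ j, min (μ (E ∩ c ⁻¹' {j})) (μ (Eᶜ ∩ c ⁻¹' {j}))

section

variable {Ω ι : Type*} [MeasurableSpace Ω] [Fintype ι] {μ : Measure Ω} {c : Ω → ι}

theorem osc_compl (E : Set Ω) : osc μ c Eᶜ = osc μ c E := by
  simp only [osc, compl_compl, min_comm]

theorem osc_union_le (E F : Set Ω) : osc μ c (E ∪ F) ≤ osc μ c E + osc μ c F := by
  rw [osc, osc, osc, ← Finset.sum_add_distrib]
  refine Finset.sum_le_sum fun j _ => ?_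
  have h1 : μ ((E ∪ F) ∩ c ⁻¹' {j}) ≤ μ (E ∩ c ⁻¹' {j}) + μ (F ∩ c ⁻¹' {j}) := by
    rw [Set.union_inter_distrib_right]
    exact measure_union_le _ _
  have h2 : μ ((E ∪ F)ᶜ ∩ c ⁻¹' {j}) ≤ μ (Eᶜ ∩ c ⁻¹' {j}) :=
    measure_mono (Set.inter_subset_inter_left _ (Set.compl_subset_compl.mpr Set.subset_union_left))
  have h3 : μ ((E ∪ F)ᶜ ∩ c ⁻¹' {j}) ≤ μ (Fᶜ ∩ c ⁻¹' {j}) :=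
    measure_mono (Set.inter_subset_inter_left _ (Set.compl_subset_compl.mpr Set.subset_union_right))
  rcases min_choice (μ (E ∩ c ⁻¹' {j})) (μ (Eᶜ ∩ c ⁻¹' {j})) with hE | hE <;>
  rcases min_choice (μ (F ∩ c ⁻¹' {j})) (μ (Fᶜ ∩ c ⁻¹' {j})) with hF | hF <;> rw [hE, hF]
  · exact (min_le_left _ _).trans h1
  · exact (min_le_right _ _).trans (h3.trans le_add_self)
  · exact (min_le_right _ _).trans (h2.trans le_self_add)
  · exact (min_le_right _ _).trans (h3.trans le_add_self)

theorem osc_le [MeasurableSpace ι] [MeasurableSingletonClass ι] (hc : Measurable c) (E : Set Ω) :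
    osc μ c E ≤ μ E := by
  rw [measure_eq_sum_fiber μ hc E]
  exact Finset.sum_le_sum fun j _ => min_le_left _ _

end

theorem osc_cell_Iic_le (N : ℕ) [NeZero N] (a : I) :
    osc volume (cell N) (Set.Iic a) ≤ (N : ℝ≥0∞)⁻¹ := by
  rw [osc, Finset.sum_eq_single (cell N a)]
  · rw [← volume_cell (cell N a)]
    exact (min_le_left _ _).trans (measure_mono Set.inter_subset_right)
  · intro j _ hj
    -- A cell that does not contain `a` lies entirely on one side of `a`.
    rcases lt_or_gt_of_ne hj with h | h
    · have : (Set.Iic a)ᶜ ∩ cell N ⁻¹' {j} = ∅ := by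
        ext y
        simp only [Set.mem_inter_iff, Set.mem_compl_iff, Set.mem_Iic, not_le, Set.mem_preimage,
          Set.mem_singleton_iff, Set.mem_empty_iff_false, iff_false, not_and]
        intro hy hc
        exact absurd (cell_mono (N := N) hy.le) (by rw [hc]; exact not_le.mpr h)
      rw [this, measure_empty, min_zero]
    · have : Set.Iic a ∩ cell N ⁻¹' {j} = ∅ := by
        ext y
        simp only [Set.mem_inter_iff, Set.mem_Iic, Set.mem_preimage,
          Set.mem_singleton_iff, Set.mem_empty_iff_false, iff_false, not_and]
        intro hy hc
        exact absurd (cell_mono (N := N) hy) (by rw [hc]; exact not_le.mpr h)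
      rw [this, measure_empty, zero_min]
  · simp

theorem generateFrom_Iic : (inferInstance : MeasurableSpace I)
    = MeasurableSpace.generateFrom (Set.range Set.Iic) := by
  rw [← borel_eq_generateFrom_Iic]
  exact BorelSpace.measurable_eq

theorem tendsto_osc_cell {N : ℕ → ℕ} [∀ n, NeZero (N n)] (hN : Tendsto N atTop atTop) {E : Set I}
    (hE : MeasurableSet E) : Tendsto (fun n => osc volume (cell (N n)) E) atTop (𝓝 0) := by
  refine tendsto_zero_of_isPiSystem (μ := volume) (C := 1) ENNReal.one_ne_top
    (fun _ => osc_union_le) (fun n E _ => by rw [one_mul]; exact osc_le measurable_cell E)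
    (fun _ => osc_compl) generateFrom_Iic isPiSystem_Iic ?_ hE
  rintro _ ⟨a, rfl⟩
  exact tendsto_of_tendsto_of_tendsto_of_le_of_le tendsto_const_nhds
    (ENNReal.tendsto_inv_nat_nhds_zero.comp hN) (fun _ => zero_le)
    fun n => osc_cell_Iic_le (N n) a

end Approximation

/-! ### Choosing a permutation by Birkhoff's theorem -/

section Birkhoff

open Finset

/-- Let `p` be a joint distribution on `ι × ι` with uniform marginals. By Birkhoff's theorem `p` is
the law of `(l, ρ l)` for a uniform `l` and an independent random permutation `ρ`, and some
permutation is at least as good as the average one; here a permutation is good if it tends to predict, up to `f`, the first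
coordinate from the second one. -/
theorem exists_perm_sum_le {ι κ : Type*} [Fintype ι] [DecidableEq ι] [Fintype κ] [DecidableEq κ]
    {p : ι → ι → ℝ} (hp : ∀ l j, 0 ≤ p l j) {N : ℝ} (hN : 0 < N) (hrow : ∀ l, ∑ j, p l j = N⁻¹)
    (hcol : ∀ j, ∑ l, p l j = N⁻¹) (f : ι → κ) :
    ∃ ρ : Equiv.Perm ι, ∑ j, ∑ l, (if f l = f (ρ⁻¹ j) then 0 else p l j) ≤
      ∑ j, ∑ i, min (∑ l, if f l = i then p l j else 0) (∑ l, if f l = i then 0 else p l j) := by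
  have hb : (Matrix.of fun l j => N * p l j) ∈ doublyStochastic ℝ ι := by
    rw [mem_doublyStochastic_iff_sum]
    refine ⟨fun l j => mul_nonneg hN.le (hp l j), fun l => ?_, fun j => ?_⟩ <;>
      simp only [Matrix.of_apply, ← mul_sum, hrow, hcol, mul_inv_cancel₀ hN.ne']
  obtain ⟨w, hw0, hw1, hw⟩ := exists_eq_sum_perm_of_mem_doublyStochastic hb
  have hwp : ∀ l j, ∑ ρ : Equiv.Perm ι, w ρ * (if ρ l = j then 1 else 0) = N * p l j := by
    intro l j
    have := congrFun (congrFun hw l) j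
    simp only [Matrix.sum_apply, Matrix.smul_apply, smul_eq_mul, Matrix.of_apply,
      Equiv.Perm.permMatrix, PEquiv.toMatrix_apply, Equiv.toPEquiv_apply, Option.mem_def,
      Option.some.injEq] at this
    exact this
  set q : κ → ι → ℝ := fun i j => ∑ l, if f l = i then p l j else 0 with hq
  set q' : κ → ι → ℝ := fun i j => ∑ l, if f l = i then 0 else p l j with hq'
  have hqq : ∀ i j, q i j + q' i j = N⁻¹ := by
    intro i j
    rw [← hcol j, hq, hq', ← sum_add_distrib]
    refine sum_congr rfl fun l _ => ?_
    split_ifs <;> simp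
  have hq0 : ∀ i j, 0 ≤ q i j := fun i j => sum_nonneg fun l _ => by split_ifs <;> simp [hp]
  have hq0' : ∀ i j, 0 ≤ q' i j := fun i j => sum_nonneg fun l _ => by split_ifs <;> simp [hp]
  -- The average of the cost over the random permutation.
  have havg : ∀ j, ∑ ρ, w ρ * q' (f (ρ⁻¹ j)) j = ∑ i, N * q i j * q' i j := by
    intro j
    have h1 : ∀ ρ : Equiv.Perm ι, q' (f (ρ⁻¹ j)) j
        = ∑ l, (if ρ l = j then 1 else 0) * q' (f l) j := by
      intro ρ
      rw [sum_eq_single (ρ⁻¹ j)]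
      · simp
      · intro l _ hl
        rw [if_neg, zero_mul]
        rintro rfl
        simp at hl
      · simp
    have h2 : ∑ ρ, w ρ * q' (f (ρ⁻¹ j)) j = ∑ l, N * p l j * q' (f l) j := by
      simp_rw [h1, mul_sum]
      rw [sum_comm]
      refine sum_congr rfl fun l _ => ?_
      rw [← hwp, sum_mul]
      exact sum_congr rfl fun ρ _ => by ring
    rw [h2]
    have h3 : ∀ i, N * q i j * q' i j
        = ∑ l, if f l = i then N * p l j * q' (f l) j else 0 := by
      intro i
      rw [hq]
      simp only [mul_sum, sum_mul]
      refine sum_congr rfl fun l _ => ?_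
      split_ifs with h
      · rw [h]
      · simp
    simp_rw [h3]
    rw [sum_comm]
    exact sum_congr rfl fun l _ => by simp
  by_contra! hcon
  have hlt : ∑ j, ∑ i, min (q i j) (q' i j) < ∑ j, ∑ ρ, w ρ * q' (f (ρ⁻¹ j)) j := by
    obtain ⟨ρ₀, -, hρ₀⟩ : ∃ ρ ∈ (univ : Finset (Equiv.Perm ι)), 0 < w ρ := by
      by_contra! h
      have := sum_nonpos h
      linarith
    calc ∑ j, ∑ i, min (q i j) (q' i j)
        = ∑ ρ, w ρ * ∑ j, ∑ i, min (q i j) (q' i j) := by rw [← sum_mul, hw1, one_mul]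
      _ < ∑ ρ, w ρ * ∑ j, q' (f (ρ⁻¹ j)) j :=
        sum_lt_sum (fun ρ _ => mul_le_mul_of_nonneg_left (hcon ρ).le (hw0 ρ))
          ⟨ρ₀, mem_univ _, mul_lt_mul_of_pos_left (hcon ρ₀) hρ₀⟩
      _ = ∑ ρ, ∑ j, w ρ * q' (f (ρ⁻¹ j)) j := by simp_rw [mul_sum]
      _ = ∑ j, ∑ ρ, w ρ * q' (f (ρ⁻¹ j)) j := sum_comm
  refine absurd hlt (not_lt.mpr (sum_le_sum fun j _ => ?_))
  rw [havg]
  refine sum_le_sum fun i _ => ?_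
  have h1 : N * q i j + N * q' i j = 1 := by rw [← mul_add, hqq, mul_inv_cancel₀ hN.ne']
  have h2 := mul_nonneg hN.le (hq0 i j)
  have h3 := mul_nonneg hN.le (hq0' i j)
  refine le_min ?_ ?_
  · have := mul_nonneg (hq0 i j) h2
    nlinarith
  · have := mul_nonneg (hq0' i j) h3
    nlinarith

/-- If `g` and `c` are uniformly distributed on `ι`, some permutation of `ι` turns `c` into a good
approximation of `g` up to `f`, provided that the level sets of `f ∘ g` are well resolved by `c`. -/
theorem exists_perm_measure_le {Ω ι κ : Type*} [MeasurableSpace Ω] {μ : Measure Ω}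
    [IsFiniteMeasure μ] [Fintype ι] [DecidableEq ι] [MeasurableSpace ι]
    [MeasurableSingletonClass ι] [Fintype κ] [DecidableEq κ] {N : ℕ} (hN : 0 < N) {g c : Ω → ι}
    (hg : Measurable g) (hc : Measurable c) (hμg : ∀ l, μ (g ⁻¹' {l}) = (N : ℝ≥0∞)⁻¹)
    (hμc : ∀ l, μ (c ⁻¹' {l}) = (N : ℝ≥0∞)⁻¹) (f : ι → κ) :
    ∃ ρ : Equiv.Perm ι, μ {x | f (g x) ≠ f (ρ⁻¹ (c x))} ≤ ∑ i, osc μ c {x | f (g x) = i} := by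
  classical
  set p : ι → ι → ℝ≥0∞ := fun l j => μ (c ⁻¹' {j} ∩ g ⁻¹' {l}) with hp
  have hfin : ∀ l j, p l j ≠ ∞ := fun l j => measure_ne_top _ _
  have hcj : ∀ l, ∑ j, p l j = (N : ℝ≥0∞)⁻¹ := by
    intro l
    rw [← hμg l, measure_eq_sum_fiber μ hc]
    exact sum_congr rfl fun j _ => by rw [hp, Set.inter_comm]
  have hgl : ∀ j, ∑ l, p l j = (N : ℝ≥0∞)⁻¹ := by
    intro j
    rw [← hμc j, measure_eq_sum_fiber μ hg]
  obtain ⟨ρ, hρ⟩ := exists_perm_sum_le (p := fun l j => (p l j).toReal) (N := N)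
    (fun _ _ => ENNReal.toReal_nonneg) (by exact_mod_cast hN)
    (fun l => by rw [← ENNReal.toReal_sum fun j _ => hfin l j, hcj]; simp)
    (fun j => by rw [← ENNReal.toReal_sum fun l _ => hfin l j, hgl]; simp) f
  refine ⟨ρ, ?_⟩
  have hsplit : ∀ (P : ι → ι → Prop) (j : ι), μ ({x | P (g x) (c x)} ∩ c ⁻¹' {j})
      = ∑ l, if P l j then p l j else 0 := by
    intro P j
    rw [measure_eq_sum_fiber μ hg]
    refine sum_congr rfl fun l _ => ?_
    split_ifs with h
    · congr 1
      ext x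
      simp only [Set.mem_inter_iff, Set.mem_ofPred_eq, Set.mem_preimage, Set.mem_singleton_iff]
      constructor
      · exact fun hx => ⟨hx.1.2, hx.2⟩
      · rintro ⟨rfl, rfl⟩
        exact ⟨⟨h, rfl⟩, rfl⟩
    · convert measure_empty (μ := μ)
      ext x
      simp only [Set.mem_inter_iff, Set.mem_ofPred_eq, Set.mem_preimage, Set.mem_singleton_iff,
        Set.mem_empty_iff_false, iff_false]
      rintro ⟨⟨hx, rfl⟩, rfl⟩
      exact h hx
  have hleft : μ {x | f (g x) ≠ f (ρ⁻¹ (c x))}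
      = ENNReal.ofReal (∑ j, ∑ l, (if f l = f (ρ⁻¹ j) then 0 else (p l j).toReal)) := by
    rw [measure_eq_sum_fiber μ hc, ENNReal.ofReal_sum_of_nonneg
      fun j _ => sum_nonneg fun l _ => by split_ifs <;> simp]
    refine sum_congr rfl fun j _ => ?_
    rw [hsplit (fun l j => f l ≠ f (ρ⁻¹ j)) j, ENNReal.ofReal_sum_of_nonneg
      fun l _ => by split_ifs <;> simp]
    refine sum_congr rfl fun l _ => ?_
    by_cases h : f l = f (ρ⁻¹ j)
    · rw [if_pos h, if_neg (not_not.mpr h), ENNReal.ofReal_zero]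
    · rw [if_neg h, if_pos h, ENNReal.ofReal_toReal (hfin l j)]
  have hright : ∑ i, osc μ c {x | f (g x) = i} = ENNReal.ofReal (∑ j, ∑ i,
      min (∑ l, if f l = i then (p l j).toReal else 0)
        (∑ l, if f l = i then 0 else (p l j).toReal)) := by
    simp only [osc]
    rw [sum_comm, ENNReal.ofReal_sum_of_nonneg fun j _ => sum_nonneg fun i _ => le_min
      (sum_nonneg fun l _ => by split_ifs <;> simp) (sum_nonneg fun l _ => by split_ifs <;> simp)]
    refine sum_congr rfl fun j _ => ?_
    rw [ENNReal.ofReal_sum_of_nonneg fun i _ => le_min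
      (sum_nonneg fun l _ => by split_ifs <;> simp) (sum_nonneg fun l _ => by split_ifs <;> simp)]
    refine sum_congr rfl fun i _ => ?_
    rw [ENNReal.ofReal_min, hsplit (fun l _ => f l = i) j]
    have h2 := hsplit (fun l _ => ¬ f l = i) j
    rw [show {x | f (g x) = i}ᶜ = {x | ¬ f (g x) = i} from rfl, h2,
      ENNReal.ofReal_sum_of_nonneg fun l _ => by split_ifs <;> simp,
      ENNReal.ofReal_sum_of_nonneg fun l _ => by split_ifs <;> simp]
    congr 1 <;> refine sum_congr rfl fun l _ => ?_ <;> by_cases h : f l = i <;>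
      simp [h, hfin l j]
  rw [hleft, hright]
  exact ENNReal.ofReal_le_ofReal hρ

end Birkhoff

/-! ### Measurable choice of a minimizer -/

section Selection

/-- Among finitely many measurable functions, an index of the smallest one can be chosen
measurably. -/
theorem exists_measurable_argmin {X P : Type*} [MeasurableSpace X] [Finite P] [Nonempty P]
    [MeasurableSpace P]     {cost : P → X → ℝ≥0∞} (hcost : ∀ ρ, Measurable (cost ρ)) :
    ∃ s : X → P, Measurable s ∧ ∀ x ρ, cost (s x) x ≤ cost ρ x := by
  classical
  obtain ⟨d, hd⟩ := exists_surjective_nat P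
  have hex : ∀ x, ∃ n, ∀ ρ, cost (d n) x ≤ cost ρ x := by
    intro x
    obtain ⟨ρ, hρ⟩ := Finite.exists_min fun ρ => cost ρ x
    obtain ⟨n, rfl⟩ := hd ρ
    exact ⟨n, hρ⟩
  refine ⟨fun x => d (Nat.find (hex x)), ?_, fun x => Nat.find_spec (hex x)⟩
  refine (measurable_from_nat (f := d)).comp (measurable_find hex fun n => ?_)
  simp only [Set.ofPred_forall]
  exact MeasurableSet.iInter fun ρ => measurableSet_le (hcost _) (hcost ρ)

end Selection

/-! ### Extensions by permutations of cells -/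

section SkewProducts

/-- The discrete σ-algebra on a finite group of permutations. -/
instance permMeasurableSpace (N : ℕ) : MeasurableSpace (Equiv.Perm (Fin N)) := ⊤

instance (N : ℕ) : DiscreteMeasurableSpace (Equiv.Perm (Fin N)) := ⟨fun _ => trivial⟩

variable {X : Type*} [MeasurableSpace X] {N : ℕ} [NeZero N]

theorem measurable_permMap_uncurry {s : X → Equiv.Perm (Fin N)} (hs : Measurable s) :
    Measurable fun z : X × I => permMap (s z.1) z.2 := by
  have h : Measurable fun z : Equiv.Perm (Fin N) × I => permMap z.1 z.2 :=
    measurable_from_prod_countable_right measurable_permMap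
  exact h.comp ((hs.comp measurable_fst).prodMk measurable_snd)

/-- The extension of `e₀` that maps the fiber over `x` to the fiber over `e₀ x` by the permutation
`s (e₀ x)` of the cells. -/
noncomputable def skewEquiv (e₀ : X ≃ᵐ X) {s : X → Equiv.Perm (Fin N)} (hs : Measurable s) :
    X × I ≃ᵐ X × I where
  toFun z := (e₀ z.1, permMap (s (e₀ z.1)) z.2)
  invFun z := (e₀.symm z.1, permMap (s z.1)⁻¹ z.2)
  left_inv z := by simp [permMap_permMap, permMap_one]
  right_inv z := by simp [permMap_permMap, permMap_one]
  measurable_toFun := (e₀.measurable.comp measurable_fst).prodMk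
    (measurable_permMap_uncurry (s := fun x => s (e₀ x)) (hs.comp e₀.measurable))
  measurable_invFun := (e₀.symm.measurable.comp measurable_fst).prodMk
    (measurable_permMap_uncurry (s := fun x => (s x)⁻¹)
      ((Measurable.of_discrete (f := fun ρ : Equiv.Perm (Fin N) => ρ⁻¹)).comp hs))

theorem measurePreserving_skewEquiv {m : Measure X} [IsProbabilityMeasure m] {e₀ : X ≃ᵐ X}
    (he₀ : MeasurePreserving e₀ m m) {s : X → Equiv.Perm (Fin N)} (hs : Measurable s) :
    MeasurePreserving (skewEquiv e₀ hs) (m.prod volume) (m.prod volume) :=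
  he₀.skew_product (g := fun x y => permMap (s (e₀ x)) y)
    (measurable_permMap_uncurry (s := fun x => s (e₀ x)) (hs.comp e₀.measurable))
    (ae_of_all _ fun _ => (measurePreserving_permMap _).map_eq)

/-- Finitely many permutations of the cells generate a finite group, so an extension by such
permutations of a periodic transformation is periodic. -/
theorem skewEquiv_periodic {m : Measure X} [IsProbabilityMeasure m] {e₀ : X ≃ᵐ X}
    {s : X → Equiv.Perm (Fin N)} (hs : Measurable s) {p : ℕ}
    (hp1 : 1 ≤ p) (hp : ∀ᵐ x ∂m, e₀^[p] x = x) :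
    ∃ r : ℕ, 1 ≤ r ∧ ∀ᵐ z ∂m.prod (volume : Measure I), (skewEquiv e₀ hs)^[r] z = z := by
  refine ⟨p * Fintype.card (Equiv.Perm (Fin N)), Nat.mul_pos hp1 Fintype.card_pos, ?_⟩
  have hit : ∀ (n : ℕ) (x : X), ∃ ρ : Equiv.Perm (Fin N), ∀ y,
      (skewEquiv e₀ hs)^[n] (x, y) = (e₀^[n] x, permMap ρ y) := by
    intro n
    induction n with
    | zero => exact fun x => ⟨1, fun y => by simp [permMap_one]⟩
    | succ n ih =>
      intro x
      obtain ⟨ρ, hρ⟩ := ih (e₀ x)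
      refine ⟨ρ * s (e₀ x), fun y => ?_⟩
      rw [Function.iterate_succ_apply, Function.iterate_succ_apply, ← permMap_permMap, ← hρ]
      rfl
  have hp' : ∀ᵐ z ∂m.prod (volume : Measure I), e₀^[p] z.1 = z.1 :=
    Measure.quasiMeasurePreserving_fst.ae hp
  filter_upwards [hp'] with ⟨x, y⟩ hx
  obtain ⟨ρ, hρ⟩ := hit p x
  have hn : ∀ (n : ℕ) (y : I), ((skewEquiv e₀ hs)^[p])^[n] (x, y) = (x, permMap (ρ ^ n) y) := by
    intro n
    induction n with
    | zero => simp [permMap_one]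
    | succ n ih =>
      intro y
      rw [Function.iterate_succ_apply, hρ, show e₀^[p] x = x from hx, ih, permMap_permMap, pow_succ]
  rw [Function.iterate_mul, hn, pow_card_eq_one, permMap_one]

end SkewProducts

/-! ### Fiber maps of an extension -/

section Fibers

variable {X Y : Type*} [MeasurableSpace X] [MeasurableSpace Y] {m : Measure X} {ν : Measure Y}

theorem ae_fst_symm_eq {e : X × Y ≃ᵐ X × Y} (he : MeasurePreserving e (m.prod ν) (m.prod ν))
    {e₀ : X ≃ᵐ X} (hext : ∀ᵐ z ∂m.prod ν, (e z).1 = e₀ z.1) :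
    ∀ᵐ z ∂m.prod ν, (e.symm z).1 = e₀.symm z.1 := by
  filter_upwards [(he.symm e).quasiMeasurePreserving.ae hext] with z hz
  rw [e.apply_symm_apply] at hz
  rw [hz, e₀.symm_apply_apply]

/-- A measure-preserving extension of a measure-preserving transformation preserves the measure on
almost every fiber. -/
theorem ae_measure_fiber_symm_eq [IsProbabilityMeasure m] [IsProbabilityMeasure ν]
    {e : X × Y ≃ᵐ X × Y} (he : MeasurePreserving e (m.prod ν) (m.prod ν)) {e₀ : X ≃ᵐ X}
    (he₀ : MeasurePreserving e₀ m m)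
    (hext : ∀ᵐ z ∂m.prod ν, (e z).1 = e₀ z.1) {J : Set Y} (hJ : MeasurableSet J) :
    ∀ᵐ x ∂m, ν {y | (e.symm (x, y)).2 ∈ J} = ν J := by
  have hS : MeasurableSet {z : X × Y | (e.symm z).2 ∈ J} :=
    (measurable_snd.comp e.symm.measurable) hJ
  refine ae_eq_of_forall_setLIntegral_eq_of_sigmaFinite
    (f := fun x => ν {y | (e.symm (x, y)).2 ∈ J}) (measurable_measure_prodMk_left hS)
    measurable_const fun B hB _ => ?_
  have h1 : ∫⁻ x in B, ν {y | (e.symm (x, y)).2 ∈ J} ∂m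
      = m.prod ν ({z | (e.symm z).2 ∈ J} ∩ B ×ˢ Set.univ) := by
    rw [← Measure.restrict_apply hS, ← Measure.prod_restrict, Measure.restrict_univ,
      Measure.prod_apply hS]
    rfl
  have h2 : m.prod ν ({z | (e.symm z).2 ∈ J} ∩ B ×ˢ Set.univ)
      = m.prod ν (e.symm ⁻¹' ((e₀ ⁻¹' B) ×ˢ J)) := by
    apply measure_congr
    filter_upwards [ae_fst_symm_eq he hext] with z hz
    apply propext
    change ((e.symm z).2 ∈ J ∧ z.1 ∈ B ∧ True) ↔ (e₀ (e.symm z).1 ∈ B ∧ (e.symm z).2 ∈ J)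
    rw [hz, e₀.apply_symm_apply]
    tauto
  rw [h1, h2, (he.symm e).measure_preimage ((e₀.measurable hB).prod hJ).nullMeasurableSet,
    Measure.prod_prod, he₀.measure_preimage hB.nullMeasurableSet, setLIntegral_const, mul_comm]

end Fibers

/-! ### Approximation of extensions by permutations of cells -/

section PeriodicApproximation

variable {X : Type*} [MeasurableSpace X] {m : Measure X} [IsProbabilityMeasure m]

/-- Up to an error of `1 / k` on the fibers, every extension coincides, outside a set of measure
`ε`, with one that permutes cells. -/
theorem exists_skewEquiv_near {e : X × I ≃ᵐ X × I}
    (he : MeasurePreserving e (m.prod volume) (m.prod volume)) {e₀ : X ≃ᵐ X}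
    (he₀ : MeasurePreserving e₀ m m)
    (hext : ∀ᵐ z ∂m.prod (volume : Measure I), (e z).1 = e₀ z.1) (k : ℕ) [NeZero k] {ε : ℝ≥0∞}
    (hε : 0 < ε) :
    ∃ (M : ℕ) (_ : NeZero M) (s : X → Equiv.Perm (Fin (k * M))) (hs : Measurable s),
      m.prod volume {z | cell k (e.symm z).2 ≠ cell k ((skewEquiv e₀ hs).symm z).2} ≤ ε := by
  set N : ℕ → ℕ := fun n => k * (n + 1) with hN
  have hNt : Tendsto N atTop atTop :=
    tendsto_atTop_mono (fun n => (Nat.le_succ n).trans (Nat.le_mul_of_pos_left _ (NeZero.pos k)))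
      tendsto_id
  set cost : ∀ n, Equiv.Perm (Fin (N n)) → X → ℝ≥0∞ := fun n ρ x =>
    volume {y | cell k (e.symm (x, y)).2 ≠ cell k (permMap ρ⁻¹ y)}
  have hu : Measurable fun z : X × I => cell k (e.symm z).2 :=
    measurable_cell.comp (measurable_snd.comp e.symm.measurable)
  have hcm : ∀ n ρ, Measurable (cost n ρ) := fun n ρ =>
    measurable_measure_prodMk_left
      (s := {z : X × I | cell k (e.symm z).2 ≠ cell k (permMap ρ⁻¹ z.2)})
      (measurableSet_eq_fun hu
        (measurable_cell.comp ((measurable_permMap ρ⁻¹).comp measurable_snd))).compl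
  choose s hs hmin using fun n => exists_measurable_argmin (hcm n)
  have hBm : ∀ n, MeasurableSet
      {z | cell k (e.symm z).2 ≠ cell k ((skewEquiv e₀ (hs n)).symm z).2} := fun n =>
    (measurableSet_eq_fun hu (measurable_cell.comp
      (measurable_snd.comp (skewEquiv e₀ (hs n)).symm.measurable))).compl
  have hint : ∀ n,
      m.prod volume {z | cell k (e.symm z).2 ≠ cell k ((skewEquiv e₀ (hs n)).symm z).2}
      = ∫⁻ x, cost n (s n x) x ∂m := fun n => Measure.prod_apply (hBm n)
  have hFm : ∀ n, Measurable fun x => cost n (s n x) x := fun n =>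
    measurable_measure_prodMk_left (hBm n)
  have hfib : ∀ᵐ x ∂m, ∀ n (l : Fin (N n)),
      volume {y | (e.symm (x, y)).2 ∈ cell (N n) ⁻¹' {l}} = (N n : ℝ≥0∞)⁻¹ := by
    refine ae_all_iff.mpr fun n => ae_all_iff.mpr fun l => ?_
    filter_upwards [ae_measure_fiber_symm_eq he he₀ hext (measurableSet_cell l)] with x hx
    rw [hx, volume_cell]
  have hlim : ∀ᵐ x ∂m, Tendsto (fun n => cost n (s n x) x) atTop (𝓝 0) := by
    filter_upwards [hfib] with x hx
    have hv : Measurable fun y : I => (e.symm (x, y)).2 :=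
      measurable_snd.comp (e.symm.measurable.comp measurable_prodMk_left)
    have h0 : Tendsto (fun n => ∑ i : Fin k, osc volume (cell (N n))
        {y | cell k (e.symm (x, y)).2 = i}) atTop (𝓝 0) := by
      have := tendsto_finsetSum Finset.univ fun (i : Fin k) _ =>
        tendsto_osc_cell hNt (E := {y | cell k (e.symm (x, y)).2 = i})
          (measurable_cell.comp hv (measurableSet_singleton i))
      simpa using this
    refine tendsto_of_tendsto_of_tendsto_of_le_of_le tendsto_const_nhds h0 (fun _ => zero_le)
      fun n => ?_
    obtain ⟨ρ, hρ⟩ := exists_perm_measure_le (μ := (volume : Measure I)) (NeZero.pos (N n))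
      (measurable_cell.comp hv) measurable_cell (hx n) volume_cell
      (Fin.divNat : Fin (k * (n + 1)) → Fin k)
    have hdiv : ∀ y, Fin.divNat (m := k) (n := n + 1) (cell (N n) y) = cell k y :=
      divNat_cell k (n + 1)
    simp only [Function.comp_apply, hdiv] at hρ
    refine (hmin n x ρ).trans (le_trans (le_of_eq (measure_congr ?_)) hρ)
    filter_upwards [ae_ne_one] with y hy
    apply propext
    change cell k (e.symm (x, y)).2 ≠ cell k (permMap ρ⁻¹ y) ↔
      cell k (e.symm (x, y)).2 ≠ Fin.divNat (m := k) (n := n + 1) (ρ⁻¹ (cell (N n) y))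
    rw [← cell_permMap ρ⁻¹ hy, hdiv]
  have hconv : Tendsto (fun n => ∫⁻ x, cost n (s n x) x ∂m) atTop (𝓝 0) := by
    have := tendsto_lintegral_of_dominated_convergence (fun _ => 1) hFm
      (fun n => ae_of_all _ fun x => prob_le_one) (by simp) hlim
    simpa using this
  obtain ⟨n, hn⟩ := (ENNReal.tendsto_nhds_zero.mp hconv ε hε).exists
  exact ⟨n + 1, inferInstance, s n, hs n, (hint n).trans_le hn⟩

theorem generateFrom_prod_Iic : (inferInstance : MeasurableSpace (X × I)) =
    MeasurableSpace.generateFrom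
      (Set.image2 (· ×ˢ ·) {B : Set X | MeasurableSet B} (Set.range Set.Iic)) :=
  (generateFrom_eq_prod MeasurableSpace.generateFrom_measurableSet generateFrom_Iic.symm
    isCountablySpanning_measurableSet
    ⟨fun _ => Set.Iic 1, fun _ => ⟨1, rfl⟩, by
      rw [Set.iUnion_const, ← Set.univ_subset_iff]; exact fun y _ => y.2.2⟩).symm

/-- Extensions of `e₀` converge weakly to `e` as soon as their inverses converge in measure to that
of `e` along the fibers. -/
theorem tendsto_measure_image_symmDiff {e : X × I ≃ᵐ X × I}
    (he : MeasurePreserving e (m.prod volume) (m.prod volume)) {e₀ : X ≃ᵐ X}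
    (hext : ∀ᵐ z ∂m.prod (volume : Measure I), (e z).1 = e₀ z.1) {f : ℕ → X × I ≃ᵐ X × I}
    (hf : ∀ n, MeasurePreserving (f n) (m.prod volume) (m.prod volume))
    (hfext : ∀ n z, ((f n).symm z).1 = e₀.symm z.1)
    (hnear : ∀ n, m.prod volume {z | cell (n + 1) (e.symm z).2 ≠ cell (n + 1) ((f n).symm z).2}
      ≤ ((n + 1 : ℕ) : ℝ≥0∞)⁻¹)
    {E : Set (X × I)} (hE : MeasurableSet E) :
    Tendsto (fun n => m.prod volume ((e '' E) ∆ (f n '' E))) atTop (𝓝 0) := by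
  simp only [MeasurableEquiv.image_eq_preimage_symm]
  refine tendsto_zero_of_isPiSystem (μ := m.prod (volume : Measure I)) (C := 2)
    (Φ := fun n E => m.prod volume ((e.symm ⁻¹' E) ∆ ((f n).symm ⁻¹' E)))
    ENNReal.ofNat_ne_top ?_ ?_ ?_ generateFrom_prod_Iic
    (MeasurableSpace.isPiSystem_measurableSet.prod isPiSystem_Iic) ?_ hE
  · intro n E F
    refine (measure_mono ?_).trans (measure_union_le _ _)
    rw [Set.preimage_union, Set.preimage_union]
    exact Set.union_symmDiff_union_subset
  · intro n E hE
    refine (measure_mono Set.symmDiff_subset_union).trans ((measure_union_le _ _).trans ?_)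
    rw [(he.symm e).measure_preimage hE.nullMeasurableSet,
      ((hf n).symm (f n)).measure_preimage hE.nullMeasurableSet, two_mul]
  · intro n E
    rw [Set.preimage_compl, Set.preimage_compl, compl_symmDiff_compl]
  · rintro _ ⟨B, hB, _, ⟨a, rfl⟩, rfl⟩
    have h0 : Tendsto (fun n : ℕ => ((n + 1 : ℕ) : ℝ≥0∞)⁻¹ + ((n + 1 : ℕ) : ℝ≥0∞)⁻¹)
        atTop (𝓝 0) := by
      have h := (tendsto_add_atTop_iff_nat 1).mpr ENNReal.tendsto_inv_nat_nhds_zero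
      simpa using h.add h
    refine tendsto_of_tendsto_of_tendsto_of_le_of_le tendsto_const_nhds h0 (fun _ => zero_le)
      fun n => ?_
    -- Off the exceptional set, the two points lie in the same cell, so they are on the same side
    -- of `a` unless this is the cell of `a`.
    have hsub : m.prod volume ((e.symm ⁻¹' (B ×ˢ Set.Iic a)) ∆ ((f n).symm ⁻¹' (B ×ˢ Set.Iic a)))
        ≤ m.prod volume ({z | cell (n + 1) (e.symm z).2 ≠ cell (n + 1) ((f n).symm z).2}
          ∪ e.symm ⁻¹' (Set.univ ×ˢ (cell (n + 1) ⁻¹' {cell (n + 1) a}))) := by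
      apply measure_mono_ae
      filter_upwards [ae_fst_symm_eq he hext] with z hz hmem
      by_contra hcon
      change ¬ (cell (n + 1) (e.symm z).2 ≠ cell (n + 1) ((f n).symm z).2 ∨
        (True ∧ cell (n + 1) (e.symm z).2 = cell (n + 1) a)) at hcon
      push Not at hcon
      obtain ⟨hc, hne⟩ := hcon
      have hne := hne trivial
      have hzf := hfext n z
      have key : (e.symm z).2 ≤ a ↔ ((f n).symm z).2 ≤ a := by
        constructor <;> intro h <;> by_contra h' <;>
          refine hne (le_antisymm ?_ ?_)
        · exact cell_mono h
        · rw [hc]; exact cell_mono (not_le.mp h').le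
        · rw [hc]; exact cell_mono h
        · exact cell_mono (not_le.mp h').le
      change ((((e.symm z).1 ∈ B ∧ (e.symm z).2 ≤ a) ∧
          ¬(((f n).symm z).1 ∈ B ∧ ((f n).symm z).2 ≤ a))
        ∨ ((((f n).symm z).1 ∈ B ∧ ((f n).symm z).2 ≤ a) ∧ ¬((e.symm z).1 ∈ B ∧ (e.symm z).2 ≤ a)))
        at hmem
      rw [hz, hzf, key] at hmem
      tauto
    refine hsub.trans ((measure_union_le _ _).trans (add_le_add (hnear n) ?_))
    rw [(he.symm e).measure_preimage
      (MeasurableSet.univ.prod (measurableSet_cell _)).nullMeasurableSet, Measure.prod_prod,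
      measure_univ, one_mul, volume_cell]

end PeriodicApproximation

/-! ### The weak topology -/

section WeakTopology

variable {Ω : Type*} [MeasurableSpace Ω] {μ : Measure Ω}

theorem ae_symm_eq {e f : Ω ≃ᵐ Ω} (he : MeasurePreserving e μ μ) (h : ∀ᵐ x ∂μ, e x = f x) :
    ∀ᵐ x ∂μ, e.symm x = f.symm x := by
  filter_upwards [(he.symm e).quasiMeasurePreserving.ae h] with x hx
  rw [e.apply_symm_apply] at hx
  rw [MeasurableEquiv.eq_symm_apply, ← hx]

theorem ae_iterate_eq {f g : Ω → Ω} (hf : Measure.QuasiMeasurePreserving f μ μ)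
    (h : ∀ᵐ x ∂μ, f x = g x) (n : ℕ) : ∀ᵐ x ∂μ, f^[n] x = g^[n] x := by
  induction n with
  | zero => exact ae_of_all _ fun _ => rfl
  | succ n ih =>
    filter_upwards [h, hf.ae ih] with x hx hn
    rw [Function.iterate_succ_apply, Function.iterate_succ_apply, hn, hx]

theorem Transf.rep_mk_image (e : Ω ≃ᵐ Ω) (he : MeasurePreserving e μ μ) (E : Set Ω) :
    (mk e he).rep '' E =ᵐ[μ] e '' E := by
  rw [MeasurableEquiv.image_eq_preimage_symm, MeasurableEquiv.image_eq_preimage_symm]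
  filter_upwards [ae_symm_eq (measurePreserving_rep _) (rep_mk e he)] with x hx
  change ((mk e he).rep.symm x ∈ E) = (e.symm x ∈ E)
  rw [hx]

theorem Transf.tendsto_nhds {ι : Type*} {l : Filter ι} {S : ι → Transf μ} {T : Transf μ}
    (h : ∀ E, MeasurableSet E → Tendsto (fun i => μ ((T.rep '' E) ∆ ((S i).rep '' E))) l (𝓝 0)) :
    Tendsto S l (𝓝 T) := by
  rw [TopologicalSpace.tendsto_nhds_generateFrom_iff]
  rintro _ ⟨T₁, E, ε, hE, -, rfl⟩ hT
  have hT : μ ((T₁.rep '' E) ∆ (T.rep '' E)) < ε := hT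
  have h0 := (h E hE).const_add (μ ((T₁.rep '' E) ∆ (T.rep '' E)))
  rw [add_zero] at h0
  filter_upwards [h0.eventually_lt_const hT] with i hi
  exact (measure_symmDiff_le _ _ _).trans_lt hi

theorem Transf.measurableSet_iterate_image (T : Transf μ) {E : Set Ω} (hE : MeasurableSet E)
    (n : ℕ) : MeasurableSet (T.rep^[n] '' E) := by
  induction n with
  | zero => simpa using hE
  | succ n ih =>
    rw [Function.iterate_succ', Set.image_comp]
    exact T.rep.measurableSet_image.mpr ih

theorem Transf.tendsto_iterate_image (T : Transf μ) {E : Set Ω} (hE : MeasurableSet E) (n : ℕ) :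
    Tendsto (fun S : Transf μ => μ ((T.rep^[n] '' E) ∆ (S.rep^[n] '' E))) (𝓝 T) (𝓝 0) := by
  induction n with
  | zero => simp
  | succ n ih =>
    have hbase : Tendsto (fun S : Transf μ => μ ((T.rep '' (T.rep^[n] '' E)) ∆
        (S.rep '' (T.rep^[n] '' E)))) (𝓝 T) (𝓝 0) := by
      rw [ENNReal.tendsto_nhds_zero]
      intro ε hε
      have hopen : IsOpen {S : Transf μ | μ ((T.rep '' (T.rep^[n] '' E)) ∆
          (S.rep '' (T.rep^[n] '' E))) < ε} :=
        TopologicalSpace.isOpen_generateFrom_of_mem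
          ⟨T, _, ε, T.measurableSet_iterate_image hE n, hε, rfl⟩
      filter_upwards [hopen.mem_nhds (by simpa using hε)] with S hS using le_of_lt hS
    have hsum := hbase.add ih
    rw [add_zero] at hsum
    refine tendsto_of_tendsto_of_tendsto_of_le_of_le tendsto_const_nhds hsum (fun _ => zero_le)
      fun S => ?_
    rw [Function.iterate_succ', Function.iterate_succ', Set.image_comp, Set.image_comp]
    refine (measure_symmDiff_le _ (S.rep '' (T.rep^[n] '' E)) _).trans (add_le_add le_rfl ?_)
    rw [← Set.image_symmDiff S.rep.injective, MeasurableEquiv.image_eq_preimage_symm,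
      (S.measurePreserving_rep.symm S.rep).measure_preimage_equiv]

theorem Transf.isOpen_lt_measure_inter_image {A : Set Ω} (hA : MeasurableSet A)
    [IsFiniteMeasure μ] (n : ℕ) (a : ℝ≥0∞) :
    IsOpen {T : Transf μ | a < μ (A ∩ T.rep^[n] '' A)} := by
  rw [isOpen_iff_mem_nhds]
  intro T hT
  have hT : a < μ (A ∩ T.rep^[n] '' A) := hT
  filter_upwards [(T.tendsto_iterate_image hA n).eventually_lt_const (tsub_pos_of_lt hT)] with S hS
  have hle : μ (A ∩ T.rep^[n] '' A)
      ≤ μ (A ∩ S.rep^[n] '' A) + μ ((T.rep^[n] '' A) ∆ (S.rep^[n] '' A)) := by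
    refine (measure_mono ?_).trans (measure_union_le _ _)
    rintro x ⟨hx, hx'⟩
    by_cases h : x ∈ S.rep^[n] '' A
    exacts [Or.inl ⟨hx, h⟩, Or.inr (Or.inl ⟨hx', h⟩)]
  change a < μ (A ∩ S.rep^[n] '' A)
  by_contra! hcon
  have h1 := ENNReal.add_lt_add_of_le_of_lt (measure_ne_top μ (A ∩ S.rep^[n] '' A)) hcon hS
  rw [add_tsub_cancel_of_le hT.le] at h1
  exact absurd hle (not_le.mpr h1)

theorem Transf.measure_inter_iterate_image (T : Transf μ) {A : Set Ω} (hA : MeasurableSet A)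
    (n : ℕ) : μ (A ∩ T.rep^[n] '' A) = μ (T.rep^[n] ⁻¹' A ∩ A) := by
  rw [← (T.measurePreserving_rep.iterate n).measure_preimage
    (hA.inter (T.measurableSet_iterate_image hA n)).nullMeasurableSet, Set.preimage_inter,
    Set.preimage_image_eq _ (T.rep.injective.iterate n)]

end WeakTopology

/-! ### Density of the periodic extensions -/

section Density

variable {X : Type*} [MeasurableSpace X] {m : Measure X} [IsProbabilityMeasure m]

/-- Every extension of a periodic transformation is a weak limit of periodic extensions. -/
theorem exists_tendsto_periodic {T₀ : Transf m} (hT₀ : T₀.IsPeriodic)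
    (T : Extension (volume : Measure I) T₀) :
    ∃ S : ℕ → Extension (volume : Measure I) T₀, Tendsto S atTop (𝓝 T) ∧
      ∀ n, ∃ r : ℕ, 1 ≤ r ∧ ∀ᵐ z ∂m.prod (volume : Measure I), (S n).1.rep^[r] z = z := by
  have hpos : ∀ n : ℕ, (0 : ℝ≥0∞) < ((n + 1 : ℕ) : ℝ≥0∞)⁻¹ := fun n =>
    ENNReal.inv_pos.mpr (ENNReal.natCast_ne_top _)
  choose M hM s hs hnear using fun n : ℕ => exists_skewEquiv_near T.1.measurePreserving_rep
    T₀.measurePreserving_rep T.2 (n + 1) (hpos n)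
  have hmp := fun n => measurePreserving_skewEquiv T₀.measurePreserving_rep (hs n)
  have hrep := fun n => Transf.rep_mk _ (hmp n)
  refine ⟨fun n => ⟨Transf.mk _ (hmp n), ?_⟩, ?_, fun n => ?_⟩
  · filter_upwards [hrep n] with z hz
    rw [hz]
    rfl
  · rw [tendsto_subtype_rng]
    refine Transf.tendsto_nhds fun E hE => ?_
    have h := tendsto_measure_image_symmDiff T.1.measurePreserving_rep T.2 hmp
      (fun _ _ => rfl) hnear hE
    refine h.congr fun n => measure_congr ?_
    exact (ae_eq_refl _).symmDiff (Transf.rep_mk_image _ (hmp n) E).symm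
  · obtain ⟨p, hp1, hp⟩ := hT₀
    obtain ⟨r, hr1, hr⟩ := skewEquiv_periodic (hs n) hp1 hp
    refine ⟨r, hr1, ?_⟩
    filter_upwards [hr, ae_iterate_eq (Transf.measurePreserving_rep _).quasiMeasurePreserving
      (hrep n) r] with z hz hz'
    rw [hz', hz]

end Density

/-! ### Consequences of strong mixing -/

section Mixing

variable {X Y : Type*} [MeasurableSpace X] [MeasurableSpace Y] {m : Measure X} {ν : Measure Y}
  [IsProbabilityMeasure m] [IsProbabilityMeasure ν]

theorem baseSigma_le : baseSigma X Y ≤ Prod.instMeasurableSpace :=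
  measurable_fst.comap_le

theorem condExp_comp_snd {E : Type*} [NormedAddCommGroup E] [NormedSpace ℝ E] [CompleteSpace E]
    {h : Y → E} (hh : StronglyMeasurable h) :
    (m.prod ν)[fun z : X × Y => h z.2 | baseSigma X Y] =ᵐ[m.prod ν] fun _ => ∫ y, h y ∂ν := by
  have hind : ProbabilityTheory.Indep (MeasurableSpace.comap Prod.snd inferInstance)
      (baseSigma X Y) (m.prod ν) :=
    (ProbabilityTheory.indepFun_prod measurable_id measurable_id).symm
  have h1 := condExp_indep_eq (f := fun z : X × Y => h z.2) measurable_snd.comap_le baseSigma_le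
    (hh.comp_measurable (comap_measurable Prod.snd)) hind
  rw [integral_fun_snd] at h1
  simpa using h1

/-- The indicator function of `X × J` is relatively square integrable. -/
theorem memCondL2_indicator_snd {J : Set Y} (hJ : MeasurableSet J) :
    MemCondL2 m ν fun z : X × Y => J.indicator (fun _ => (1 : ℂ)) z.2 := by
  have hsm : StronglyMeasurable (J.indicator (fun _ => (1 : ℂ))) :=
    stronglyMeasurable_const.indicator hJ
  refine ⟨MemLp.of_bound (hsm.comp_measurable measurable_snd).aestronglyMeasurable 1
    (ae_of_all _ fun z => ?_), ?_⟩
  · exact (norm_indicator_le_norm_self _ _).trans (by simp)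
  · have h := condExp_comp_snd (m := m) (ν := ν)
      (h := fun y => ‖J.indicator (fun _ => (1 : ℂ)) y‖ ^ 2) (hsm.norm.pow 2)
    refine (memLp_const (√(∫ y, ‖J.indicator (fun _ => (1 : ℂ)) y‖ ^ 2 ∂ν))).ae_eq ?_
    filter_upwards [h] with z hz
    rw [condNorm, hz]

/-- For a strongly mixing extension, `X × J` becomes asymptotically independent of its iterates. -/
theorem IsStronglyMixingExtension.tendsto_measure {T₀ : Transf m} {T : Transf (m.prod ν)}
    (h : IsStronglyMixingExtension T₀ T) {J : Set Y} (hJ : MeasurableSet J) :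
    Tendsto (fun n => m.prod ν (T.rep^[n] ⁻¹' (Prod.snd ⁻¹' J) ∩ Prod.snd ⁻¹' J)) atTop
      (𝓝 (ν J * ν J)) := by
  set f : X × Y → ℂ := fun z => J.indicator (fun _ => (1 : ℂ)) z.2 with hf
  have hsm : StronglyMeasurable (J.indicator (fun _ => (1 : ℂ))) :=
    stronglyMeasurable_const.indicator hJ
  have hlim := h f f (memCondL2_indicator_snd hJ) (memCondL2_indicator_snd hJ)
  have hconj : (fun w => starRingEnd ℂ (f w)) = f := by
    funext w
    by_cases hw : w.2 ∈ J <;> simp [hf, hw]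
  have hcond : (m.prod ν)[f | baseSigma X Y] =ᵐ[m.prod ν] fun _ => (ν.real J : ℂ) := by
    refine (condExp_comp_snd hsm).trans (ae_of_all _ fun _ => ?_)
    simp [integral_indicator_const _ hJ]
  have hA : MeasurableSet (Prod.snd ⁻¹' J : Set (X × Y)) := measurable_snd hJ
  have hTn : ∀ n, MeasurePreserving T.rep^[n] (m.prod ν) (m.prod ν) := fun n =>
    T.measurePreserving_rep.iterate n
  have hprod : ∀ n, (fun w => f (T.rep^[n] w) * starRingEnd ℂ (f w))
      = (T.rep^[n] ⁻¹' (Prod.snd ⁻¹' J) ∩ Prod.snd ⁻¹' J).indicator fun _ => (1 : ℂ) := by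
    intro n
    funext w
    rw [show starRingEnd ℂ (f w) = f w from congrFun hconj w]
    by_cases h1 : w.2 ∈ J <;> by_cases h2 : (T.rep^[n] w).2 ∈ J <;> simp [hf, h1, h2, Set.indicator]
  set D : ℕ → X × Y → ℂ := fun n z =>
    ((m.prod ν)[fun w => f (T.rep^[n] w) * starRingEnd ℂ (f w) | baseSigma X Y]) z
      - ((m.prod ν)[f | baseSigma X Y]) (T₀.rep^[n] z.1, z.2)
        * ((m.prod ν)[fun w => starRingEnd ℂ (f w) | baseSigma X Y]) z with hD
  have hDae : ∀ n, D n =ᵐ[m.prod ν] fun z =>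
      ((m.prod ν)[fun w => f (T.rep^[n] w) * starRingEnd ℂ (f w) | baseSigma X Y]) z
        - (ν.real J : ℂ) * ν.real J := by
    intro n
    have hshift : ∀ᵐ z ∂m.prod ν,
        ((m.prod ν)[f | baseSigma X Y]) (T₀.rep^[n] z.1, z.2) = ν.real J :=
      ((T₀.measurePreserving_rep.iterate n).prod
        (MeasurePreserving.id ν)).quasiMeasurePreserving.ae hcond
    filter_upwards [hcond, hshift] with z h1 h2
    simp only [hD, hconj]
    rw [h1, h2]
  have hint : ∀ n, ∫ z, D n z ∂m.prod ν
      = (((m.prod ν).real (T.rep^[n] ⁻¹' (Prod.snd ⁻¹' J) ∩ Prod.snd ⁻¹' J)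
          - ν.real J * ν.real J : ℝ) : ℂ) := by
    intro n
    rw [integral_congr_ae (hDae n), integral_sub integrable_condExp (integrable_const _),
      integral_condExp baseSigma_le, hprod,
      integral_indicator_const _ (((hTn n).measurable hA).inter hA)]
    simp
  have hDm : ∀ n, AEStronglyMeasurable (D n) (m.prod ν) := fun n =>
    (integrable_condExp.aestronglyMeasurable.sub aestronglyMeasurable_const).congr (hDae n).symm
  have hzero : Tendsto (fun n => ‖∫ z, D n z ∂m.prod ν‖ₑ) atTop (𝓝 0) := by
    refine tendsto_of_tendsto_of_tendsto_of_le_of_le tendsto_const_nhds hlim (fun _ => zero_le)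
      fun n => ?_
    calc ‖∫ z, D n z ∂m.prod ν‖ₑ ≤ ∫⁻ z, ‖D n z‖ₑ ∂m.prod ν := enorm_integral_le_lintegral_enorm _
      _ = eLpNorm (D n) 1 (m.prod ν) := eLpNorm_one_eq_lintegral_enorm.symm
      _ ≤ eLpNorm (D n) 2 (m.prod ν) :=
        eLpNorm_le_eLpNorm_of_exponent_le (by norm_num) (hDm n)
  have hreal : Tendsto (fun n => (m.prod ν).real
      (T.rep^[n] ⁻¹' (Prod.snd ⁻¹' J) ∩ Prod.snd ⁻¹' J)) atTop (𝓝 (ν.real J * ν.real J)) := by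
    rw [tendsto_iff_norm_sub_tendsto_zero]
    have h1 := (ENNReal.tendsto_toReal ENNReal.zero_ne_top).comp hzero
    refine h1.congr fun n => ?_
    simp only [Function.comp_apply, hint, toReal_enorm, Complex.norm_real]
  have h2 := ENNReal.tendsto_ofReal hreal
  simp only [Measure.real, ← ENNReal.toReal_mul] at h2
  simpa [ENNReal.ofReal_toReal, measure_ne_top, ENNReal.mul_ne_top] using h2

end Mixing

/-! ### Meagreness of the strongly mixing extensions -/

/-- The strongly mixing extensions to `X × [0, 1]` of a periodic transformation of a probability
space `X` form a meagre set. -/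
theorem isMeagre_stronglyMixingExtensions {X : Type*} [MeasurableSpace X] {m : Measure X}
    [IsProbabilityMeasure m] {T₀ : Transf m} (hT₀ : T₀.IsPeriodic) :
    IsMeagre (stronglyMixingExtensions (volume : Measure I) T₀) := by
  set J : Set I := cell 2 ⁻¹' {0}
  have hJ : MeasurableSet J := measurableSet_cell 0
  have hνJ : volume J = 2⁻¹ := volume_cell 0
  set A : Set (X × I) := Prod.snd ⁻¹' J
  have hA : MeasurableSet A := measurable_snd hJ
  have hμA : m.prod volume A = 2⁻¹ := by
    rw [measurePreserving_snd.measure_preimage hJ.nullMeasurableSet, hνJ]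
  -- The threshold `1 / 3` lies strictly between the value `1 / 4` forced by mixing and the
  -- value `1 / 2` attained when an iterate is the identity.
  set G : ℕ → Set (Extension (volume : Measure I) T₀) := fun N =>
    ⋃ n ≥ N, {T | 3⁻¹ < m.prod volume (A ∩ T.1.rep^[n] '' A)}
  have hopen : ∀ N, IsOpen (G N) := fun N =>
    isOpen_biUnion fun n _ =>
      (Transf.isOpen_lt_measure_inter_image hA n 3⁻¹).preimage continuous_subtype_val
  have hdense : ∀ N, Dense (G N) := by
    intro N T
    obtain ⟨S, hST, hS⟩ := exists_tendsto_periodic hT₀ T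
    refine mem_closure_of_tendsto hST (Eventually.of_forall fun k => ?_)
    obtain ⟨r, hr1, hr⟩ := hS k
    refine Set.mem_biUnion (x := r * N) (Nat.le_mul_of_pos_left N hr1) ?_
    have hid : ∀ᵐ z ∂m.prod (volume : Measure I), (S k).1.rep^[r * N] z = z := by
      have := ae_iterate_eq ((S k).1.measurePreserving_rep.iterate r).quasiMeasurePreserving hr N
      filter_upwards [this] with z hz
      rw [Function.iterate_mul, hz]
      exact congrFun (Function.iterate_id N) z
    change 3⁻¹ < m.prod volume (A ∩ (S k).1.rep^[r * N] '' A)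
    have hself : m.prod volume ((S k).1.rep^[r * N] ⁻¹' A ∩ A) = m.prod volume A := by
      apply measure_congr
      filter_upwards [hid] with z hz
      apply propext
      change ((S k).1.rep^[r * N] z ∈ A ∧ z ∈ A) ↔ z ∈ A
      rw [hz, and_self]
    rw [Transf.measure_inter_iterate_image _ hA, hself, hμA]
    exact ENNReal.inv_lt_inv.mpr (by norm_num)
  have hres : (⋂ N, G N) ∈ residual (Extension (volume : Measure I) T₀) :=
    countable_iInter_mem.mpr fun N => residual_of_dense_open (hopen N) (hdense N)
  refine mem_of_superset hres fun T hT hmix => ?_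
  have hlim := IsStronglyMixingExtension.tendsto_measure hmix hJ
  have hlt : volume J * volume J < (3⁻¹ : ℝ≥0∞) := by
    rw [hνJ, ← ENNReal.mul_inv (by simp) (by simp)]
    exact ENNReal.inv_lt_inv.mpr (by norm_num)
  obtain ⟨N, hN⟩ := eventually_atTop.mp (hlim.eventually_lt_const hlt)
  obtain ⟨n, hn, hn'⟩ := Set.mem_iUnion₂.mp (Set.mem_iInter.mp hT N)
  have hn' : 3⁻¹ < m.prod volume (A ∩ T.1.rep^[n] '' A) := hn'
  rw [Transf.measure_inter_iterate_image _ hA] at hn'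
  exact lt_asymm hn' (hN n hn)

end MixExt

theorem mainTheorem2 (T₀ : MixExt.Transf (volume : Measure I)) (hT₀ : T₀.IsPeriodic) :
    IsMeagre (MixExt.stronglyMixingExtensions (volume : Measure I) T₀) :=
  MixExt.isMeagre_stronglyMixingExtensions hT₀
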